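/- Let $k$ be a field and let $A$ be a finite-dimensional associative unital $k$-algebra. Let $\mathsf{tors}\,A$ be the complete lattice, ordered by inclusion, of torsion classes of the category $\mathsf{mod}\,A$ of finitely generated left $A$-modules, that is, of classes of modules that contain $0$ and are closed under factor modules, isomorphisms and extensions. For a complete lattice $L$, the arrows $x\to y$ of its Hasse quiver are the pairs such that $x$ covers $y$; a congruence contracts $x\to y$ if it identifies $x$ and $y$. An arrow $q$ forces an arrow $q'$ if every lattice congruence of $L$ that contracts $q$ also contracts $q'$, and $q,q'$ are forcing equivalent if each forces the other. A completely join-irreducible element $j$ (one such that $j=\bigvee S$ implies $j\in S$) is the source of exactly one arrow $j\to j_*$; dually, a completely meet-irreducible element $m$ is the target of exactly one arrow $m^*\to m$. A brick is a module whose endomorphism ring is a division ring. For every arrow $q:\mathcal T\to\mathcal U$ of the Hasse quiver of $\mathsf{tors}\,A$ there is, up to isomorphism, exactly one brick $S_q$ in $\mathcal T\cap\mathcal U^\perp$, where $\mathcal U^\perp=\{X\mid \mathrm{Hom}_A(U,X)=0 \text{ for all } U\in\mathcal U\}$; it is called the label of $q$. The following hold. (a) Two arrows $q,q'$ of the Hasse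 quiver of $\mathsf{tors}\,A$ are forcing equivalent if and only if $S_q\cong S_{q'}$. Moreover, every brick is the label of some arrow, so that $q\mapsto S_q$ induces a bijection from forcing equivalence classes of arrows to isomorphism classes of bricks. (b) The lattice $L=\mathsf{tors}\,A$ is completely congruence uniform, that is: forcing (of the arrows $j\to j_*$) is a partial order on the set of completely join-irreducible elements of $L$, and the map sending a congruence to the set of completely join-irreducible elements $j$ such that it contracts $j\to j_*$ is a bijection from the set of arrow-determined complete congruences of $L$ to the set of those sets of completely join-irreducible elements that are closed under forcing; and the same holds for completely meet-irreducible elements $m$ and the arrows $m^*\to m$. Here a congruence is complete if it is compatible with arbitrary joins and meets, and arrow-determined if, for all $x\le y$, it identifies $x$ and $y$ if and only if it contracts all arrows of the Hasse quiver of the interval $[x,y]$. (c) The maps $j\mapsto S_{j\to j_*}$ and $m\mapsto S_{m^*\to m}$ are bijections from the completely join-irreducible, respectively completely meet-irreducible, elements of $\mathsf{tors}\,A$ to the isomorphism classes of bricks. For every arrow $q:\mathcal T\to\mathcal U$ there is exactly one completely join-irreducible element $\gamma(q)$ such that $\gamma(q)\to\gamma(q)_*$ is forcing equivalent to $q$ (the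 join-irreducible label of $q$), and exactly one completely meet-irreducible element $\mu(q)$ such that $\mu(q)^*\to\mu(q)$ is forcing equivalent to $q$ (the meet-irreducible label of $q$); $\gamma(q)$ is the least torsion class $\mathcal V$ with $\mathcal U\vee\mathcal V=\mathcal T$, and $\mu(q)$ is the greatest torsion class $\mathcal V$ with $\mathcal T\wedge\mathcal V=\mathcal U$. Under the two bijections above, $\gamma(q)$ and $\mu(q)$ both correspond to $S_q$; that is, the brick labelling coincides with the join-irreducible and with the meet-irreducible labelling. -/

import Mathlib

universe u v

/-! ### Hasse quivers, congruences and forcing in complete lattices -/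

/-- An arrow `src → tgt` of the Hasse quiver of `L`: `src` covers `tgt`. -/
@[ext]
structure HasseArrow (L : Type v) [Preorder L] where
  src : L
  tgt : L
  covBy : tgt ⋖ src

section Lattices

variable {L : Type v} [CompleteLattice L]

/-- The congruence `Θ` contracts the arrow `q`. -/
def LatticeCon.Contracts (Θ : LatticeCon L) (q : HasseArrow L) : Prop :=
  Θ.r q.src q.tgt

/-- The arrow `q` forces `q'`: every lattice congruence contracting `q` contracts `q'`. -/
def Forces (q q' : HasseArrow L) : Prop :=
  ∀ Θ : LatticeCon L, Θ.Contracts q → Θ.Contracts q'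

/-- Forcing equivalence of arrows. -/
def ForcingEquiv (q q' : HasseArrow L) : Prop :=
  Forces q q' ∧ Forces q' q

/-- A lattice congruence that is compatible with arbitrary joins and meets. -/
def LatticeCon.IsComplete (Θ : LatticeCon L) : Prop :=
  ∀ (ι : Type v) (x y : ι → L), (∀ i, Θ.r (x i) (y i)) →
    Θ.r (⨆ i, x i) (⨆ i, y i) ∧ Θ.r (⨅ i, x i) (⨅ i, y i)

/-- `Θ` is arrow-determined: for `x ≤ y`, one has `x ≡ y` if and only if `Θ` contracts all arrows
of the Hasse quiver of the interval `[x, y]`. -/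
def LatticeCon.IsArrowDetermined (Θ : LatticeCon L) : Prop :=
  ∀ x y : L, x ≤ y →
    (Θ.r x y ↔ ∀ q : HasseArrow L, x ≤ q.tgt → q.src ≤ y → Θ.Contracts q)

variable (L) in
/-- The set of arrow-determined complete congruences of `L`. -/
def arrowDeterminedCongruences : Set (LatticeCon L) :=
  {Θ | Θ.IsComplete ∧ Θ.IsArrowDetermined}

variable (L) in
/-- The completely join-irreducible elements of `L`. -/
def CJIrr : Type v := {j : L // ∀ S : Set L, j = sSup S → j ∈ S}

variable (L) in
/-- The completely meet-irreducible elements of `L`. -/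
def CMIrr : Type v := {m : L // ∀ S : Set L, m = sInf S → m ∈ S}

/-- The unique arrow `j → j_*` starting at a completely join-irreducible element `j`. -/
def CJIrr.arrow (j : CJIrr L) : HasseArrow L where
  src := j.1
  tgt := sSup (Set.Iio j.1)
  covBy := by
    have hle : sSup (Set.Iio j.1) ≤ j.1 := sSup_le fun _ hx => le_of_lt hx
    have hne : sSup (Set.Iio j.1) ≠ j.1 := fun h =>
      lt_irrefl j.1 (Set.mem_Iio.1 (j.2 _ h.symm))
    exact ⟨lt_of_le_of_ne hle hne, fun _ h1 h2 => not_lt_of_ge (le_sSup (Set.mem_Iio.2 h2)) h1⟩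

/-- The unique arrow `m^* → m` ending at a completely meet-irreducible element `m`. -/
def CMIrr.arrow (m : CMIrr L) : HasseArrow L where
  src := sInf (Set.Ioi m.1)
  tgt := m.1
  covBy := by
    have hle : m.1 ≤ sInf (Set.Ioi m.1) := le_sInf fun _ hx => le_of_lt hx
    have hne : m.1 ≠ sInf (Set.Ioi m.1) := fun h =>
      lt_irrefl m.1 (Set.mem_Ioi.1 (m.2 _ h))
    exact ⟨lt_of_le_of_ne hle hne, fun _ h1 h2 => not_lt_of_ge (sInf_le (Set.mem_Ioi.2 h1)) h2⟩

theorem CJIrr.arrow_unique (j : CJIrr L) (q : HasseArrow L) (h : q.src = j.1) : q = j.arrow := by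
  refine HasseArrow.ext h ?_
  have h1 : q.tgt ≤ j.arrow.tgt := le_sSup (show q.tgt < j.1 from h ▸ q.covBy.lt)
  refine (q.covBy.eq_or_eq h1 (h ▸ j.arrow.covBy.le)).elim Eq.symm fun h2 => ?_
  exact absurd (h2.trans h) j.arrow.covBy.lt.ne

theorem CMIrr.arrow_unique (m : CMIrr L) (q : HasseArrow L) (h : q.tgt = m.1) : q = m.arrow := by
  refine HasseArrow.ext ?_ h
  have h1 : m.arrow.src ≤ q.src := sInf_le (show m.1 < q.src from h ▸ q.covBy.lt)
  refine (q.covBy.eq_or_eq (h ▸ m.arrow.covBy.le) h1).elim (fun h2 => ?_) Eq.symm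
  exact absurd (h2.trans h) m.arrow.covBy.lt.ne'

/-- A set `I` is closed under the relation `r`: if `a ∈ I` and `r a b`, then `b ∈ I`. -/
def IsForcingIdeal {X : Type v} (r : X → X → Prop) (I : Set X) : Prop :=
  ∀ a ∈ I, ∀ b, r a b → b ∈ I

variable (L) in
/-- `L` is completely congruence uniform: forcing is a partial order on the completely
join-irreducible elements, and sending a congruence to the set of completely join-irreducible
elements that it contracts is a bijection from arrow-determined complete congruences to sets of
completely join-irreducible elements closed under forcing; and likewise for completely
meet-irreducible elements. -/
def IsCompletelyCongruenceUniform : Prop :=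
  (IsPartialOrder (CJIrr L) (fun j j' => Forces j.arrow j'.arrow) ∧
    Set.BijOn (fun (Θ : LatticeCon L) => {j : CJIrr L | Θ.Contracts j.arrow})
      (arrowDeterminedCongruences L)
      {I | IsForcingIdeal (fun j j' : CJIrr L => Forces j.arrow j'.arrow) I}) ∧
  (IsPartialOrder (CMIrr L) (fun m m' => Forces m.arrow m'.arrow) ∧
    Set.BijOn (fun (Θ : LatticeCon L) => {m : CMIrr L | Θ.Contracts m.arrow})
      (arrowDeterminedCongruences L)
      {I | IsForcingIdeal (fun m m' : CMIrr L => Forces m.arrow m'.arrow) I})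

/-- `γ` is the join-irreducible labelling of the Hasse quiver of `L`: `γ q` is the unique completely
join-irreducible element `j` such that `j → j_*` is forcing equivalent to `q`. -/
def IsJoinIrreducibleLabelling (γ : HasseArrow L → CJIrr L) : Prop :=
  ∀ (q : HasseArrow L) (j : CJIrr L), ForcingEquiv j.arrow q ↔ j = γ q

/-- `μ` is the meet-irreducible labelling of the Hasse quiver of `L`: `μ q` is the unique completely
meet-irreducible element `m` such that `m^* → m` is forcing equivalent to `q`. -/
def IsMeetIrreducibleLabelling (μ : HasseArrow L → CMIrr L) : Prop :=
  ∀ (q : HasseArrow L) (m : CMIrr L), ForcingEquiv m.arrow q ↔ m = μ q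

end Lattices

/-! ### Torsion classes and bricks -/

section Modules

variable (A : Type u) [Ring A]

/-- A torsion class in the category of finitely generated left `A`-modules: it contains the zero
modules and is closed under factor modules (hence under isomorphisms) and extensions. -/
@[ext]
structure TorsionClass where
  carrier : Set (FGModuleCat.{u} A)
  zero_mem : ∀ M : FGModuleCat.{u} A, Subsingleton M → M ∈ carrier
  quotient_mem : ∀ (M N : FGModuleCat.{u} A) (f : M →ₗ[A] N), Function.Surjective f →
    M ∈ carrier → N ∈ carrier
  extension_mem : ∀ (M N P : FGModuleCat.{u} A) (f : M →ₗ[A] N) (g : N →ₗ[A] P),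
    Function.Injective f → Function.Exact f g → Function.Surjective g →
    M ∈ carrier → P ∈ carrier → N ∈ carrier

variable {A}

namespace TorsionClass

/-- Torsion classes are ordered by inclusion. -/
instance : PartialOrder (TorsionClass A) :=
  PartialOrder.lift carrier fun _ _ h => TorsionClass.ext h

/-- The meet of a set of torsion classes is their intersection. -/
instance : InfSet (TorsionClass A) where
  sInf S :=
    { carrier := {M | ∀ T ∈ S, M ∈ T.carrier}
      zero_mem := fun M hM T _ => T.zero_mem M hM
      quotient_mem := fun M N f hf hM T hT => T.quotient_mem M N f hf (hM T hT)
      extension_mem := fun M N P f g hf hfg hg hM hP T hT =>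
        T.extension_mem M N P f g hf hfg hg (hM T hT) (hP T hT) }

theorem isGLB_sInf (S : Set (TorsionClass A)) : IsGLB S (sInf S) :=
  ⟨fun T hT _ hM => hM T hT, fun _ hU _ hM _ hT => hU hT hM⟩

/-- The complete lattice of torsion classes; joins are the meets of all upper bounds. -/
instance : CompleteLattice (TorsionClass A) :=
  completeLatticeOfInf (TorsionClass A) isGLB_sInf

/-- The right orthogonal class of `T`: the modules `X` with `Hom(M, X) = 0` for all `M ∈ T`. -/
def perp (T : TorsionClass A) : Set (FGModuleCat.{u} A) :=
  {X | ∀ M ∈ T.carrier, ∀ f : M →ₗ[A] X, f = 0}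

end TorsionClass

/-- A brick: a module whose endomorphism ring is a division ring. -/
def IsBrick (S : FGModuleCat.{u} A) : Prop :=
  Nontrivial S ∧ ∀ f : Module.End A S, f ≠ 0 → IsUnit f

variable (A) in
/-- The bricks of `A`, as finitely generated modules. -/
abbrev Brick : Type (u + 1) := {S : FGModuleCat.{u} A // IsBrick S}

/-- Isomorphism of bricks. -/
instance brickSetoid : Setoid (Brick A) where
  r S S' := Nonempty (S.1 ≃ₗ[A] S'.1)
  iseqv := ⟨fun _ => ⟨LinearEquiv.refl A _⟩, fun ⟨e⟩ => ⟨e.symm⟩, fun ⟨e⟩ ⟨e'⟩ => ⟨e.trans e'⟩⟩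

variable (A) in
/-- The set of isomorphism classes of bricks of `A`. -/
abbrev BrickClass : Type (u + 1) := Quotient (brickSetoid (A := A))

/-- The set of isomorphism classes of bricks that lie in `T` and in the right orthogonal of `U`. -/
def bricksBetween (U T : TorsionClass A) : Set (BrickClass A) :=
  {B | ∃ S : Brick A, Quotient.mk _ S = B ∧ S.1 ∈ T.carrier ∧ S.1 ∈ U.perp}

/-- `lab` is the brick labelling: for each arrow `q : T → U`, the class `lab q` is the unique
isomorphism class of bricks lying in `T` and in the right orthogonal of `U`. -/
def IsBrickLabelling (lab : HasseArrow (TorsionClass A) → BrickClass A) : Prop :=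
  ∀ q : HasseArrow (TorsionClass A), bricksBetween q.tgt q.src = {lab q}

end Modules

/-!
For a brick `S`, the torsion class `gen S` generated by `S` and the class `leftPerp S` of modules
without nonzero maps to `S` form a double arrow: each proper torsion subclass of `gen S` lies in
`leftPerp S`, and each torsion class properly containing `leftPerp S` contains `S`. Whenever a
torsion class `T` is not contained in `U`, some brick lies in `T` and in the right orthogonal of
`U`, so each Hasse arrow `q` is labelled by such a pair. Semidistributivity makes `gen S` the least
`V` with `q.tgt ⊔ V = q.src` and `leftPerp S` the greatest `V` with `q.src ⊓ V = q.tgt`, so the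
brick is unique.

A congruence contracts `q` exactly when it identifies `gen S` with `gen S ⊓ leftPerp S`, so arrows
with the same label are forcing equivalent. Conversely, agreeing on the subquotients of a fixed
module `N` is a congruence on torsion classes. Since it does not contract an arrow labelled by `N`,
the label of an arrow forcing that arrow is a subquotient of `N`, and comparing lengths shows that
forcing equivalent arrows have isomorphic labels.

Finally, `gen S` is compact and `leftPerp S` is cocompact, so any interval on which one of them
separates the end points contains an arrow forcing the arrows labelled `S`. This is what makes the
lower and the upper description of the congruence attached to a forcing ideal agree.
-/

section Polarity

variable {α : Type*} {L : Type v}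

/-- The lattice congruence identifying two elements when the same `J a` lie below them, provided
that this happens exactly when they lie below the same `M a`. The lower description makes the
relation compatible with meets, the upper one with joins. -/
def polarCon [Lattice L] (J M : α → L)
    (h : ∀ x y, (∀ a, J a ≤ x ↔ J a ≤ y) ↔ ∀ a, x ≤ M a ↔ y ≤ M a) : LatticeCon L where
  r x y := ∀ a, J a ≤ x ↔ J a ≤ y
  iseqv := ⟨fun _ _ => Iff.rfl, fun h a => (h a).symm, fun h h' a => (h a).trans (h' a)⟩
  inf hxy hzw a := by rw [le_inf_iff, le_inf_iff, hxy a, hzw a]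
  sup hxy hzw := (h _ _).2 fun a => by
    rw [sup_le_iff, sup_le_iff, (h _ _).1 hxy a, (h _ _).1 hzw a]

theorem polarCon_isComplete [CompleteLattice L] {J M : α → L}
    (h : ∀ x y, (∀ a, J a ≤ x ↔ J a ≤ y) ↔ ∀ a, x ≤ M a ↔ y ≤ M a) :
    (polarCon J M h).IsComplete := fun ι x y hxy =>
  ⟨(h _ _).2 fun a => by
      simp only [iSup_le_iff]
      exact forall_congr' fun i => (h _ _).1 (hxy i) a,
    fun a => by
      simp only [le_iInf_iff]
      exact forall_congr' fun i => hxy i a⟩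

end Polarity

section CompactElements

variable {L : Type v} [CompleteLattice L]

theorem exists_covBy_sup_of_isCompactElement {j x : L} (hj : IsCompactElement j) (hx : ¬ j ≤ x) :
    ∃ w, x ≤ w ∧ ¬ j ≤ w ∧ w ⋖ x ⊔ j := by
  obtain ⟨w, hxw, hw⟩ := zorn_le_nonempty₀ {w | w ≤ x ⊔ j ∧ ¬ j ≤ w} (fun c hc hchain y hy =>
    ⟨sSup c, ⟨sSup_le fun z hz => (hc hz).1, fun hjc => by
      obtain ⟨z, hz, hjz⟩ := hj c _ ⟨y, hy⟩ hchain.directedOn (isLUB_sSup c) hjc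
      exact (hc hz).2 hjz⟩, fun z hz => le_sSup hz⟩) x ⟨le_sup_left, hx⟩
  have hlt : w < x ⊔ j := lt_of_le_of_ne hw.prop.1 fun h => hw.prop.2 (h ▸ le_sup_right)
  exact ⟨w, hxw, hw.prop.2, hlt, fun z hwz hz => hw.not_prop_of_gt hwz
    ⟨hz.le, fun hjz => hz.not_ge (sup_le (hxw.trans hwz.le) hjz)⟩⟩

theorem exists_inf_covBy_of_isCompactElement_toDual {m y : L}
    (hm : IsCompactElement (OrderDual.toDual m)) (hy : ¬ y ≤ m) :
    ∃ w, w ≤ y ∧ ¬ w ≤ m ∧ y ⊓ m ⋖ w := by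
  obtain ⟨w, hyw, hmw, hw⟩ := exists_covBy_sup_of_isCompactElement hm (x := OrderDual.toDual y) hy
  exact ⟨OrderDual.ofDual w, hyw, hmw, hw.toDual⟩

end CompactElements

/-! ### Labels of Hasse arrows -/

/-- Day's double arrow relation: `j` is minimal among the elements not below `m`, and `m` is maximal
among the elements not above `j`. -/
structure DoubleArrow {L : Type v} [Preorder L] (j m : L) : Prop where
  not_le : ¬ j ≤ m
  le_of_lt : ∀ x, x < j → x ≤ m
  le_of_gt : ∀ x, m < x → j ≤ x

/-- The pair `(j, m)` labels the arrow `q`: it is a double arrow separating the two ends of `q`. -/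
structure HasseArrow.HasLabel {L : Type v} [Preorder L] (q : HasseArrow L) (j m : L) : Prop extends
    DoubleArrow j m where
  le_src : j ≤ q.src
  tgt_le : q.tgt ≤ m

namespace HasseArrow.HasLabel

variable {L : Type v} [Lattice L] {j m : L} {q : HasseArrow L}

theorem tgt_sup_eq (h : q.HasLabel j m) : q.tgt ⊔ j = q.src :=
  (q.covBy.eq_or_eq le_sup_left (sup_le q.covBy.le h.le_src)).resolve_left fun he =>
    h.not_le ((sup_eq_left.1 he).trans h.tgt_le)

theorem src_inf_eq (h : q.HasLabel j m) : q.src ⊓ m = q.tgt :=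
  (q.covBy.eq_or_eq (le_inf q.covBy.le h.tgt_le) inf_le_left).resolve_right fun he =>
    h.not_le (h.le_src.trans (inf_eq_left.1 he))

end HasseArrow.HasLabel

section Labels

variable {L : Type v} [CompleteLattice L] {j m : L} {q q' : HasseArrow L}

namespace DoubleArrow

/-- The lower end of a double arrow, as a completely join-irreducible element. -/
def cjirr (h : DoubleArrow j m) : CJIrr L :=
  ⟨j, fun S hS => by
    by_contra hj
    refine h.not_le (hS.trans_le (sSup_le fun x hx => h.le_of_lt x ?_))
    exact lt_of_le_of_ne (hS ▸ le_sSup hx) (ne_of_mem_of_not_mem hx hj)⟩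

/-- The upper end of a double arrow, as a completely meet-irreducible element. -/
def cmirr (h : DoubleArrow j m) : CMIrr L :=
  ⟨m, fun S hS => by
    by_contra hm
    refine h.not_le (le_of_le_of_eq (le_sInf fun x hx => h.le_of_gt x ?_) hS.symm)
    exact lt_of_le_of_ne (hS ▸ sInf_le hx) (ne_of_mem_of_not_mem hx hm).symm⟩

theorem hasLabel_cjirr_arrow (h : DoubleArrow j m) : h.cjirr.arrow.HasLabel j m :=
  ⟨h, le_rfl, sSup_le h.le_of_lt⟩

theorem hasLabel_cmirr_arrow (h : DoubleArrow j m) : h.cmirr.arrow.HasLabel j m :=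
  ⟨h, le_sInf h.le_of_gt, le_rfl⟩

end DoubleArrow

namespace HasseArrow.HasLabel

theorem contracts_iff (h : q.HasLabel j m) (Θ : LatticeCon L) :
    Θ.Contracts q ↔ Θ.r j (j ⊓ m) := by
  constructor
  · intro hq
    have hj := Θ.inf (Θ.refl j) hq
    rwa [inf_eq_left.2 h.le_src, ← h.src_inf_eq, ← inf_assoc, inf_eq_left.2 h.le_src] at hj
  · intro hj
    have hq := Θ.sup (Θ.refl q.tgt) hj
    rwa [h.tgt_sup_eq, sup_eq_left.2 (h.src_inf_eq ▸ inf_le_inf_right m h.le_src)] at hq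

theorem forcingEquiv (h : q.HasLabel j m) (h' : q'.HasLabel j m) : ForcingEquiv q q' :=
  ⟨fun Θ hq => (h'.contracts_iff Θ).2 ((h.contracts_iff Θ).1 hq),
    fun Θ hq => (h.contracts_iff Θ).2 ((h'.contracts_iff Θ).1 hq)⟩

theorem eq_of_cjirr_arrow {i : CJIrr L} (h : i.arrow.HasLabel j m) : j = i.1 :=
  h.le_src.eq_of_not_lt fun hlt => h.not_le ((le_sSup hlt : j ≤ i.arrow.tgt).trans h.tgt_le)

theorem eq_of_cmirr_arrow {i : CMIrr L} (h : i.arrow.HasLabel j m) : m = i.1 :=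
  Eq.symm <| h.tgt_le.eq_of_not_lt fun hlt =>
    h.not_le (h.le_src.trans (sInf_le hlt : i.arrow.src ≤ m))

theorem exists_forces_of_isCompactElement (h : q.HasLabel j m) (hj : IsCompactElement j) {x y : L}
    (hxy : x ≤ y) (hjy : j ≤ y) (hjx : ¬ j ≤ x) :
    ∃ p : HasseArrow L, x ≤ p.tgt ∧ p.src ≤ y ∧ Forces p q := by
  obtain ⟨w, hxw, hjw, hw⟩ := exists_covBy_sup_of_isCompactElement hj hjx
  refine ⟨⟨x ⊔ j, w, hw⟩, hxw, sup_le hxy hjy, fun Θ hp => (h.contracts_iff Θ).2 ?_⟩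
  have hwj : j ⊓ w ≤ j ⊓ m := le_inf inf_le_left (h.le_of_lt _ (inf_lt_left.2 hjw))
  have hr : Θ.r j (j ⊓ w) := by simpa only [inf_sup_self, sup_comm x] using Θ.inf (Θ.refl j) hp
  simpa only [sup_inf_self, sup_eq_right.2 hwj] using Θ.sup hr (Θ.refl (j ⊓ m))

theorem exists_forces_of_isCompactElement_toDual (h : q.HasLabel j m)
    (hm : IsCompactElement (OrderDual.toDual m)) {x y : L} (hxy : x ≤ y) (hxm : x ≤ m)
    (hym : ¬ y ≤ m) : ∃ p : HasseArrow L, x ≤ p.tgt ∧ p.src ≤ y ∧ Forces p q := by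
  obtain ⟨w, hwy, hwm, hw⟩ := exists_inf_covBy_of_isCompactElement_toDual hm hym
  refine ⟨⟨w, y ⊓ m, hw⟩, le_inf hxy hxm, hwy, fun Θ hp => (h.contracts_iff Θ).2 ?_⟩
  have hjw : j ≤ w ⊔ m := h.le_of_gt _ (right_lt_sup.2 hwm)
  have hr : Θ.r (w ⊔ m) m := by
    simpa only [sup_eq_right.2 (inf_le_right : y ⊓ m ≤ m)] using Θ.sup hp (Θ.refl m)
  simpa only [inf_eq_left.2 hjw] using Θ.inf (Θ.refl j) hr

end HasseArrow.HasLabel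

end Labels

/-! ### Semidistributive lattices -/

/-- Semidistributivity of a lattice, in the cancellation form of Jónsson. -/
structure IsSemidistributive (L : Type v) [Lattice L] : Prop where
  sup_inf_eq : ∀ x y z : L, x ⊔ y = x ⊔ z → x ⊔ y ⊓ z = x ⊔ y
  inf_sup_eq : ∀ x y z : L, x ⊓ y = x ⊓ z → x ⊓ (y ⊔ z) = x ⊓ y

namespace IsSemidistributive

variable {L : Type v} [Lattice L] {q : HasseArrow L} {j m : L}

theorem isLeast_of_hasLabel (hL : IsSemidistributive L) (h : q.HasLabel j m) :
    IsLeast {x | q.tgt ⊔ x = q.src} j := by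
  refine ⟨h.tgt_sup_eq, fun x (hx : q.tgt ⊔ x = q.src) => ?_⟩
  have hinf : q.tgt ⊔ j ⊓ x = q.src :=
    (hL.sup_inf_eq _ _ _ (h.tgt_sup_eq.trans hx.symm)).trans h.tgt_sup_eq
  refine inf_eq_left.1 (inf_le_left.eq_of_not_lt fun hlt => h.not_le ?_)
  exact h.le_src.trans (hinf ▸ sup_le h.tgt_le (h.le_of_lt _ hlt))

theorem isGreatest_of_hasLabel (hL : IsSemidistributive L) (h : q.HasLabel j m) :
    IsGreatest {x | q.src ⊓ x = q.tgt} m := by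
  refine ⟨h.src_inf_eq, fun x (hx : q.src ⊓ x = q.tgt) => ?_⟩
  have hsup : q.src ⊓ (m ⊔ x) = q.tgt :=
    (hL.inf_sup_eq _ _ _ (h.src_inf_eq.trans hx.symm)).trans h.src_inf_eq
  refine sup_eq_left.1 (Eq.symm <| le_sup_left.eq_of_not_lt fun hlt => h.not_le ?_)
  exact (le_inf h.le_src (h.le_of_gt _ hlt)).trans (hsup.trans_le h.tgt_le)

end IsSemidistributive

/-! ### Complete congruence uniformity -/

section ForcingIdeals

variable {L : Type v} [CompleteLattice L]

theorem injOn_contracts :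
    Set.InjOn (fun Θ : LatticeCon L => {q : HasseArrow L | Θ.Contracts q})
      (arrowDeterminedCongruences L) := by
  intro Θ hΘ Θ' hΘ' h
  have hiff : ∀ q, Θ.Contracts q ↔ Θ'.Contracts q := Set.ext_iff.1 h
  have hr : ∀ x y, Θ.r x y ↔ Θ'.r x y := fun x y => by
    rw [← Θ.r_inf_sup_iff, ← Θ'.r_inf_sup_iff, hΘ.2 _ _ inf_le_sup, hΘ'.2 _ _ inf_le_sup]
    simp only [hiff]
  cases Θ
  cases Θ'
  congr 1
  exact Setoid.ext hr

theorem bijOn_preimage_forcingIdeals {X : Type v} (a : X → HasseArrow L)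
    (ha : ∀ q, ∃ x, ForcingEquiv (a x) q) :
    Set.BijOn (fun I : Set (HasseArrow L) => a ⁻¹' I) {I | IsForcingIdeal Forces I}
      {I | IsForcingIdeal (fun x y => Forces (a x) (a y)) I} := by
  refine ⟨fun I hI x hx y hxy => hI _ hx _ hxy, fun I hI I' hI' h => ?_, fun K hK => ?_⟩
  · have hiff : ∀ x, a x ∈ I ↔ a x ∈ I' := Set.ext_iff.1 h
    ext q
    obtain ⟨x, hx⟩ := ha q
    exact ⟨fun hq => hI' _ ((hiff x).1 (hI _ hq _ hx.2)) _ hx.1,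
      fun hq => hI _ ((hiff x).2 (hI' _ hq _ hx.2)) _ hx.1⟩
  · refine ⟨{q | ∃ x ∈ K, Forces (a x) q}, ?_, ?_⟩
    · rintro p ⟨x, hx, hxp⟩ q hpq
      exact ⟨x, hx, fun Θ hΘ => hpq Θ (hxp Θ hΘ)⟩
    · ext y
      exact ⟨fun ⟨x, hx, hxy⟩ => hK x hx y hxy, fun hy => ⟨y, hy, fun _ => id⟩⟩

end ForcingIdeals

/-- A labelling of the Hasse arrows of `L` by double arrows `(γ q, μ q)` whose lower ends are
compact and whose upper ends are compact in the dual lattice. -/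
structure IsCompactLabelling {L : Type v} [CompleteLattice L] (γ μ : HasseArrow L → L) : Prop where
  hasLabel : ∀ q : HasseArrow L, q.HasLabel (γ q) (μ q)
  isCompactElement : ∀ q, IsCompactElement (γ q)
  isCompactElement_toDual : ∀ q, IsCompactElement (OrderDual.toDual (μ q))

namespace IsCompactLabelling

variable {L : Type v} [CompleteLattice L] {γ μ : HasseArrow L → L}

theorem forall_le_iff (h : IsCompactLabelling γ μ) {I : Set (HasseArrow L)}
    (hI : IsForcingIdeal Forces I) (x y : L) :
    (∀ q : ↥Iᶜ, γ q ≤ x ↔ γ q ≤ y) ↔ ∀ q : ↥Iᶜ, x ≤ μ q ↔ y ≤ μ q := by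
  constructor
  · suffices key : ∀ x y : L, (∀ q : ↥Iᶜ, γ q ≤ x ↔ γ q ≤ y) → ∀ q : ↥Iᶜ, x ≤ μ q → y ≤ μ q from
      fun hxy q => ⟨key x y hxy q, key y x (fun p => (hxy p).symm) q⟩
    rintro x y hxy ⟨q, hq⟩ hx
    by_contra hy
    obtain ⟨p, hp, hpy, hpq⟩ := (h.hasLabel q).exists_forces_of_isCompactElement_toDual
      (h.isCompactElement_toDual q) inf_le_right (inf_le_left.trans hx) hy
    have hγ : γ p ≤ y := (h.hasLabel p).le_src.trans hpy
    have hγ' : γ p ≤ x := (hxy ⟨p, fun hpI => hq (hI p hpI q hpq)⟩).2 hγ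
    exact (h.hasLabel p).not_le ((le_inf hγ' hγ).trans (hp.trans (h.hasLabel p).tgt_le))
  · suffices key : ∀ x y : L, (∀ q : ↥Iᶜ, x ≤ μ q ↔ y ≤ μ q) → ∀ q : ↥Iᶜ, γ q ≤ x → γ q ≤ y from
      fun hxy q => ⟨key x y hxy q, key y x (fun p => (hxy p).symm) q⟩
    rintro x y hxy ⟨q, hq⟩ hx
    by_contra hy
    obtain ⟨p, hyp, hp, hpq⟩ := (h.hasLabel q).exists_forces_of_isCompactElement
      (h.isCompactElement q) le_sup_right (hx.trans le_sup_left) hy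
    have hμ : y ≤ μ p := hyp.trans (h.hasLabel p).tgt_le
    have hμ' : x ≤ μ p := (hxy ⟨p, fun hpI => hq (hI p hpI q hpq)⟩).2 hμ
    exact (h.hasLabel p).not_le ((h.hasLabel p).le_src.trans (hp.trans (sup_le hμ' hμ)))

/-- The complete congruence that contracts exactly the arrows in a given forcing ideal. -/
def idealCon (h : IsCompactLabelling γ μ) {I : Set (HasseArrow L)}
    (hI : IsForcingIdeal Forces I) : LatticeCon L :=
  polarCon (fun q : ↥Iᶜ => γ q) (fun q : ↥Iᶜ => μ q) (h.forall_le_iff hI)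

theorem idealCon_contracts_iff (h : IsCompactLabelling γ μ) {I : Set (HasseArrow L)}
    (hI : IsForcingIdeal Forces I) (q : HasseArrow L) :
    (h.idealCon hI).Contracts q ↔ q ∈ I := by
  constructor
  · intro hq
    by_contra hqI
    exact (h.hasLabel q).not_le (((hq ⟨q, hqI⟩).1 (h.hasLabel q).le_src).trans
      (h.hasLabel q).tgt_le)
  · rintro hq ⟨p, hp⟩
    refine ⟨fun hsrc => ?_, fun htgt => htgt.trans q.covBy.le⟩
    by_contra htgt
    obtain ⟨r, hr, hr', hrp⟩ := (h.hasLabel p).exists_forces_of_isCompactElement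
      (h.isCompactElement p) q.covBy.le hsrc htgt
    have hrq : r = q := by
      have hle : r.tgt < q.src := r.covBy.lt.trans_le hr'
      have htgt_eq : r.tgt = q.tgt := (q.covBy.eq_or_eq hr hle.le).resolve_right hle.ne
      have hlt : q.tgt < r.src := hr.trans_lt r.covBy.lt
      exact HasseArrow.ext ((q.covBy.eq_or_eq hlt.le hr').resolve_left hlt.ne') htgt_eq
    exact hp (hI q hq p (hrq ▸ hrp))

theorem idealCon_isArrowDetermined (h : IsCompactLabelling γ μ) {I : Set (HasseArrow L)}
    (hI : IsForcingIdeal Forces I) : (h.idealCon hI).IsArrowDetermined := by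
  refine fun x y hxy => ⟨fun hr q hxq hqy => ?_, fun hc => ?_⟩
  · refine (h.idealCon_contracts_iff hI q).2 (by_contra fun hq => (h.hasLabel q).not_le ?_)
    exact ((hr ⟨q, hq⟩).2 ((h.hasLabel q).le_src.trans hqy)).trans
      (hxq.trans (h.hasLabel q).tgt_le)
  · rintro ⟨q, hq⟩
    refine ⟨fun hx => hx.trans hxy, fun hy => by_contra fun hx => ?_⟩
    obtain ⟨p, hxp, hpy, hpq⟩ := (h.hasLabel q).exists_forces_of_isCompactElement
      (h.isCompactElement q) hxy hy hx
    exact hq (hI p ((h.idealCon_contracts_iff hI p).1 (hc p hxp hpy)) q hpq)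

theorem bijOn_contracts (h : IsCompactLabelling γ μ) :
    Set.BijOn (fun Θ : LatticeCon L => {q : HasseArrow L | Θ.Contracts q})
      (arrowDeterminedCongruences L) {I | IsForcingIdeal Forces I} :=
  ⟨fun Θ _ _ hq _ hqp => hqp Θ hq, injOn_contracts, fun _ hI => ⟨h.idealCon hI,
    ⟨polarCon_isComplete _, h.idealCon_isArrowDetermined hI⟩,
    Set.ext (h.idealCon_contracts_iff hI)⟩⟩

theorem isJoinIrreducibleLabelling (h : IsCompactLabelling γ μ)
    (hγ : ∀ q q', ForcingEquiv q q' → γ q = γ q') :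
    IsJoinIrreducibleLabelling fun q => (h.hasLabel q).cjirr := by
  refine fun q j => ⟨fun hj => Subtype.ext ?_, ?_⟩
  · exact (h.hasLabel j.arrow).eq_of_cjirr_arrow.symm.trans (hγ _ _ hj)
  · rintro rfl
    exact (h.hasLabel q).hasLabel_cjirr_arrow.forcingEquiv (h.hasLabel q)

theorem isMeetIrreducibleLabelling (h : IsCompactLabelling γ μ)
    (hμ : ∀ q q', ForcingEquiv q q' → μ q = μ q') :
    IsMeetIrreducibleLabelling fun q => (h.hasLabel q).cmirr := by
  refine fun q m => ⟨fun hm => Subtype.ext ?_, ?_⟩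
  · exact (h.hasLabel m.arrow).eq_of_cmirr_arrow.symm.trans (hμ _ _ hm)
  · rintro rfl
    exact (h.hasLabel q).hasLabel_cmirr_arrow.forcingEquiv (h.hasLabel q)

theorem isPartialOrder_bijOn (h : IsCompactLabelling γ μ) {X : Type v} (a : X → HasseArrow L)
    (κ : HasseArrow L → X) (hκ : ∀ q x, ForcingEquiv (a x) q ↔ x = κ q) :
    IsPartialOrder X (fun x y => Forces (a x) (a y)) ∧
      Set.BijOn (fun Θ : LatticeCon L => {x | Θ.Contracts (a x)}) (arrowDeterminedCongruences L)
        {I | IsForcingIdeal (fun x y => Forces (a x) (a y)) I} := by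
  refine ⟨?_, (bijOn_preimage_forcingIdeals a fun q => ⟨κ q, (hκ q _).2 rfl⟩).comp
    h.bijOn_contracts⟩
  have hκa : ∀ x, κ (a x) = x := fun x => ((hκ (a x) x).1 ⟨fun _ => id, fun _ => id⟩).symm
  exact
    { refl := fun _ _ => id
      trans := fun _ _ _ hxy hyz Θ hΘ => hyz Θ (hxy Θ hΘ)
      antisymm := fun x y hxy hyx => ((hκ (a y) x).1 ⟨hxy, hyx⟩).trans (hκa y) }

theorem isCompletelyCongruenceUniform (h : IsCompactLabelling γ μ)
    (heq : ∀ q q', ForcingEquiv q q' → γ q = γ q' ∧ μ q = μ q') :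
    IsCompletelyCongruenceUniform L :=
  ⟨h.isPartialOrder_bijOn CJIrr.arrow _
      (h.isJoinIrreducibleLabelling fun q q' hq => (heq q q' hq).1),
    h.isPartialOrder_bijOn CMIrr.arrow _
      (h.isMeetIrreducibleLabelling fun q q' hq => (heq q q' hq).2)⟩

end IsCompactLabelling

section ForcingClasses

variable {L : Type v} [CompleteLattice L] {β : Type*} {lab : HasseArrow L → β} {X : Type*}
  {a : X → HasseArrow L} {κ : HasseArrow L → X}

theorem lab_eq_of_forcingEquiv_iff (hlab : ∀ q q', lab q = lab q' ↔ ForcingEquiv q q')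
    (hκ : ∀ q x, ForcingEquiv (a x) q ↔ x = κ q) (q : HasseArrow L) : lab (a (κ q)) = lab q :=
  (hlab _ _).2 ((hκ q _).2 rfl)

theorem bijective_of_forcingEquiv_iff (hlab : ∀ q q', lab q = lab q' ↔ ForcingEquiv q q')
    (hκ : ∀ q x, ForcingEquiv (a x) q ↔ x = κ q) (hsurj : Function.Surjective lab) :
    Function.Bijective fun x => lab (a x) := by
  refine ⟨fun x y hxy => ?_, fun b => ?_⟩
  · exact ((hκ (a y) x).1 ((hlab _ _).1 hxy)).trans ((hκ (a y) y).1 ((hlab _ _).1 rfl)).symm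
  · obtain ⟨q, rfl⟩ := hsurj b
    exact ⟨κ q, lab_eq_of_forcingEquiv_iff hlab hκ q⟩

end ForcingClasses

open FGModuleCat (of)

/-! ### Subquotients of modules -/

/-- `M` is a factor module of a submodule of `N`. -/
def IsSubquotient (A : Type*) [Ring A] (M N : Type*) [AddCommGroup M] [Module A M] [AddCommGroup N]
    [Module A N] : Prop :=
  ∃ (K : Submodule A N) (f : K →ₗ[A] M), Function.Surjective f

namespace IsSubquotient

variable {A : Type*} [Ring A] {M N P : Type*} [AddCommGroup M] [Module A M] [AddCommGroup N]
  [Module A N] [AddCommGroup P] [Module A P]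

variable (A M) in
theorem refl : IsSubquotient A M M :=
  ⟨⊤, Submodule.topEquiv.toLinearMap, Submodule.topEquiv.surjective⟩

theorem of_surjective (h : IsSubquotient A M P) (p : M →ₗ[A] N) (hp : Function.Surjective p) :
    IsSubquotient A N P :=
  let ⟨K, f, hf⟩ := h
  ⟨K, p ∘ₗ f, hp.comp hf⟩

theorem of_injective (h : IsSubquotient A N P) (i : M →ₗ[A] N) (hi : Function.Injective i) :
    IsSubquotient A M P := by
  obtain ⟨K, f, hf⟩ := h
  let K' : Submodule A K := (LinearMap.range i).comap f
  let g : K' →ₗ[A] LinearMap.range i := f.restrict fun _ hx => hx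
  have hg : Function.Surjective g := fun ⟨y, hy⟩ => by
    obtain ⟨x, rfl⟩ := hf y
    exact ⟨⟨x, hy⟩, rfl⟩
  let e := LinearEquiv.ofInjective i hi
  let e' := K.equivSubtypeMap K'
  exact ⟨K'.map K.subtype, e.symm.toLinearMap ∘ₗ g ∘ₗ e'.symm.toLinearMap,
    e.symm.surjective.comp (hg.comp e'.symm.surjective)⟩

theorem trans (h : IsSubquotient A M N) (h' : IsSubquotient A N P) : IsSubquotient A M P :=
  let ⟨K, f, hf⟩ := h
  (h'.of_injective K.subtype K.injective_subtype).of_surjective f hf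

theorem length_le (h : IsSubquotient A M N) : Module.length A M ≤ Module.length A N :=
  let ⟨K, f, hf⟩ := h
  (Module.length_le_of_surjective f hf).trans
    (Module.length_le_of_injective K.subtype K.injective_subtype)

theorem nonempty_equiv [IsNoetherian A N] [IsArtinian A N] (h : IsSubquotient A M N)
    (hle : Module.length A N ≤ Module.length A M) : Nonempty (M ≃ₗ[A] N) := by
  obtain ⟨K, f, hf⟩ := h
  have hK : K = ⊤ := by
    by_contra hK
    exact ((Module.length_le_of_surjective f hf).trans_lt (Submodule.length_lt hK)).not_ge hle
  subst hK
  have hker : LinearMap.ker f = ⊥ := by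
    by_contra hne
    have hlt := Submodule.length_quotient_lt _ hne
    rw [(f.quotKerEquivOfSurjective hf).length_eq, Module.length_top] at hlt
    exact hlt.not_ge hle
  exact ⟨(LinearEquiv.ofBijective f ⟨LinearMap.ker_eq_bot.1 hker, hf⟩).symm.trans
    Submodule.topEquiv⟩

end IsSubquotient

/-! ### Torsion classes generated by a module and left orthogonals -/

namespace TorsionClass

variable {A : Type u} [Ring A] {T U V : TorsionClass A} {M N : FGModuleCat.{u} A}

theorem mem_of_equiv (T : TorsionClass A) (e : M ≃ₗ[A] N) (h : M ∈ T.carrier) : N ∈ T.carrier :=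
  T.quotient_mem M N e e.surjective h

theorem mem_inf : M ∈ (T ⊓ U).carrier ↔ M ∈ T.carrier ∧ M ∈ U.carrier :=
  ⟨fun h => ⟨(inf_le_left : T ⊓ U ≤ T) h, (inf_le_right : T ⊓ U ≤ U) h⟩, fun h V hV => by
    rcases hV with rfl | rfl
    exacts [h.1, h.2]⟩

theorem range_mem (T : TorsionClass A) (f : M →ₗ[A] N) (h : M ∈ T.carrier) :
    of A (LinearMap.range f) ∈ T.carrier :=
  T.quotient_mem M (of A (LinearMap.range f)) f.rangeRestrict f.surjective_rangeRestrict h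

theorem mem_of_range_of_quotient (T : TorsionClass A) (f : M →ₗ[A] N) (hM : M ∈ T.carrier)
    (hN : of A (N ⧸ LinearMap.range f) ∈ T.carrier) : N ∈ T.carrier :=
  T.extension_mem (of A (LinearMap.range f)) N (of A (N ⧸ LinearMap.range f))
    (LinearMap.range f).subtype (LinearMap.range f).mkQ (Submodule.injective_subtype _)
    (LinearMap.exact_subtype_mkQ _) (Submodule.mkQ_surjective _) (T.range_mem f hM) hN

/-- The smallest torsion class containing `M`. -/
def gen (M : FGModuleCat.{u} A) : TorsionClass A := sInf {T | M ∈ T.carrier}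

theorem mem_gen (M : FGModuleCat.{u} A) : M ∈ (gen M).carrier := fun _ hT => hT

theorem gen_le_iff : gen M ≤ T ↔ M ∈ T.carrier :=
  ⟨fun h => h (mem_gen M), fun h => sInf_le h⟩

theorem gen_eq_of_equiv (e : M ≃ₗ[A] N) : gen M = gen N :=
  le_antisymm (gen_le_iff.2 ((gen N).mem_of_equiv e.symm (mem_gen N)))
    (gen_le_iff.2 ((gen M).mem_of_equiv e (mem_gen M)))

/-- The torsion class of all modules without nonzero homomorphisms to `M`. -/
def leftPerp (M : FGModuleCat.{u} A) : TorsionClass A where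
  carrier := {X | ∀ f : X →ₗ[A] M, f = 0}
  zero_mem X _ f := Subsingleton.elim f 0
  quotient_mem X Y g hg hX f := LinearMap.cancel_right hg |>.1 (hX (f ∘ₗ g))
  extension_mem X Y Z i p _ hip hp hX hZ f := by
    have hker : LinearMap.ker p ≤ LinearMap.ker f := by
      rw [LinearMap.exact_iff.1 hip, LinearMap.range_le_ker_iff]
      exact hX (f ∘ₗ i)
    obtain ⟨g, rfl⟩ : ∃ g : Z →ₗ[A] M, g ∘ₗ p = f :=
      ⟨(LinearMap.ker p).liftQ f hker ∘ₗ (p.quotKerEquivOfSurjective hp).symm.toLinearMap, by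
        ext x
        simp [LinearMap.quotKerEquivOfSurjective_symm_apply]⟩
    rw [hZ g, LinearMap.zero_comp]

theorem leftPerp_le_of_injective (i : M →ₗ[A] N) (hi : Function.Injective i) :
    leftPerp N ≤ leftPerp M := fun _ hX f =>
  (LinearMap.cancel_left hi).1 ((hX (i ∘ₗ f)).trans i.comp_zero.symm)

theorem leftPerp_eq_of_equiv (e : M ≃ₗ[A] N) : leftPerp M = leftPerp N :=
  le_antisymm (leftPerp_le_of_injective e.symm.toLinearMap e.symm.injective)
    (leftPerp_le_of_injective e.toLinearMap e.injective)

theorem not_le_leftPerp_iff :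
    ¬ T ≤ leftPerp M ↔ ∃ X ∈ T.carrier, ∃ f : X →ₗ[A] M, f ≠ 0 := by
  refine Set.not_subset.trans (exists_congr fun X => and_congr_right fun _ => ?_)
  exact not_forall

theorem not_le_leftPerp_of_mem [Nontrivial M] (h : M ∈ T.carrier) : ¬ T ≤ leftPerp M := fun hT =>
  one_ne_zero (α := Module.End A M) (hT h LinearMap.id)

theorem exists_ne_zero_of_mem_gen [Nontrivial N] (h : N ∈ (gen M).carrier) :
    ∃ f : M →ₗ[A] N, f ≠ 0 := by
  by_contra! hzero
  exact not_le_leftPerp_of_mem h (gen_le_iff.2 hzero)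

theorem nontrivial_of_notMem (h : M ∉ T.carrier) : Nontrivial M :=
  not_subsingleton_iff_nontrivial.1 fun hM => h (T.zero_mem M hM)

theorem mem_of_not_le_leftPerp (hquot : ∀ K : Submodule A M, K ≠ ⊥ → of A (M ⧸ K) ∈ U.carrier)
    (hUV : U ≤ V) (hV : ¬ V ≤ leftPerp M) : M ∈ V.carrier := by
  obtain ⟨X, hX, f, hf⟩ := not_le_leftPerp_iff.1 hV
  exact V.mem_of_range_of_quotient f hX (hUV (hquot _ (mt LinearMap.range_eq_bot.1 hf)))

theorem exists_minimal_quotient_notMem [IsNoetherian A M] (hM : M ∉ U.carrier) :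
    ∃ (Q : FGModuleCat.{u} A) (p : M →ₗ[A] Q), Function.Surjective p ∧ Q ∉ U.carrier ∧
      ∀ K : Submodule A Q, K ≠ ⊥ → of A (Q ⧸ K) ∈ U.carrier := by
  obtain ⟨N, hN, hmax⟩ := set_has_maximal_iff_noetherian.2 ‹IsNoetherian A M›
    {N : Submodule A M | of A (M ⧸ N) ∉ U.carrier}
    ⟨⊥, fun h => hM (U.mem_of_equiv (M := of A (M ⧸ ⊥)) (Submodule.quotEquivOfEqBot ⊥ rfl) h)⟩
  refine ⟨of A (M ⧸ N), N.mkQ, N.mkQ_surjective, hN, fun K hK => by_contra fun hKU => ?_⟩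
  let L : Submodule A M := K.comap N.mkQ
  have hNL : N ≤ L := (N.ker_mkQ.symm.le).trans (LinearMap.ker_le_comap _)
  have hL : of A (M ⧸ L) ∉ U.carrier := fun h =>
    hKU (U.quotient_mem (of A (M ⧸ L)) (of A ((M ⧸ N) ⧸ K)) (L.mapQ K N.mkQ le_rfl)
      (.of_comp (g := L.mkQ) (K.mkQ_surjective.comp N.mkQ_surjective)) h)
  have hLN : L = N := (hNL.eq_of_not_lt (hmax L hL)).symm
  refine hK (?_ : K = ⊥)
  rw [← Submodule.map_comap_eq_of_surjective N.mkQ_surjective K]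
  exact (congrArg (Submodule.map N.mkQ) hLN).trans N.mkQ_map_self

end TorsionClass

/-! ### Compactness -/

namespace TorsionClass

variable {A : Type u} [Ring A] {T U : TorsionClass A} {M : FGModuleCat.{u} A}

/-- The union of a nonempty directed set of torsion classes. -/
def directedUnion (s : Set (TorsionClass A)) (hs : s.Nonempty) (hdir : DirectedOn (· ≤ ·) s) :
    TorsionClass A where
  carrier := {M | ∃ T ∈ s, M ∈ T.carrier}
  zero_mem M hM := hs.imp fun T hT => ⟨hT, T.zero_mem M hM⟩
  quotient_mem M N f hf := fun ⟨T, hT, hM⟩ => ⟨T, hT, T.quotient_mem M N f hf hM⟩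
  extension_mem M N P f g hf hfg hg := fun ⟨T, hT, hM⟩ ⟨U, hU, hP⟩ =>
    let ⟨V, hV, hTV, hUV⟩ := hdir T hT U hU
    ⟨V, hV, V.extension_mem M N P f g hf hfg hg (hTV hM) (hUV hP)⟩

theorem isCompactElement_gen (M : FGModuleCat.{u} A) : IsCompactElement (gen M) := by
  rw [CompleteLattice.isCompactElement_iff_le_of_directed_sSup_le]
  intro s hs hdir hM
  have hle : sSup s ≤ directedUnion s hs hdir := sSup_le fun T hT _ hX => ⟨T, hT, hX⟩
  obtain ⟨T, hT, hMT⟩ := hle (gen_le_iff.1 hM)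
  exact ⟨T, hT, gen_le_iff.2 hMT⟩

section Noetherian

variable [IsNoetherian A M]

theorem eq_bot_of_le_leftPerp {N : Submodule A M} (hT : T ≤ leftPerp M)
    (hN : of A N ∈ T.carrier) : N = ⊥ := by
  rw [← N.range_subtype, LinearMap.range_eq_bot]
  exact hT hN N.subtype

theorem sup_mem {N N' : Submodule A M} (h : of A N ∈ T.carrier) (h' : of A N' ∈ T.carrier) :
    of A (N ⊔ N' : Submodule A M) ∈ T.carrier := by
  have hprod : of A (N × N') ∈ T.carrier :=
    T.extension_mem (of A N) (of A (N × N')) (of A N') (LinearMap.inl A N N')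
      (LinearMap.snd A N N') LinearMap.inl_injective Function.Exact.inl_snd
      LinearMap.snd_surjective h h'
  have hrange : LinearMap.range (N.subtype.coprod N'.subtype) = N ⊔ N' := by
    rw [LinearMap.range_coprod, N.range_subtype, N'.range_subtype]
  exact T.mem_of_equiv (LinearEquiv.ofEq _ _ hrange)
    (T.range_mem (M := of A (N × N')) (N := M) (N.subtype.coprod N'.subtype) hprod)

variable (T M) in
/-- The sum of all submodules of `M` that belong to `T`, which is the largest such submodule. -/
def torsionSubmodule : Submodule A M := sSup {N | of A N ∈ T.carrier}

variable (T M) in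
theorem torsionSubmodule_mem : of A (torsionSubmodule T M) ∈ T.carrier :=
  (CompleteLattice.WellFoundedGT.isSupFiniteCompact (Submodule A M)).isSupClosedCompact _
    {N | of A N ∈ T.carrier}
    ⟨⊥, T.zero_mem _ (inferInstanceAs (Subsingleton (⊥ : Submodule A M)))⟩
    fun _ h _ h' => sup_mem h h'

variable (M) in
theorem torsionSubmodule_mono (h : T ≤ U) : torsionSubmodule T M ≤ torsionSubmodule U M :=
  sSup_le_sSup fun _ hN => h hN

theorem le_leftPerp_of_torsionSubmodule_eq_bot (h : torsionSubmodule T M = ⊥) : T ≤ leftPerp M :=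
  fun _ hX f => LinearMap.range_eq_bot.1 <| le_bot_iff.1 <| h ▸ le_sSup (T.range_mem f hX)

theorem exists_le_leftPerp_of_sInf_le [IsArtinian A M] {s : Set (TorsionClass A)}
    (hs : s.Nonempty) (hdir : DirectedOn (· ≥ ·) s) (h : sInf s ≤ leftPerp M) :
    ∃ T ∈ s, T ≤ leftPerp M := by
  obtain ⟨_, ⟨T, hT, rfl⟩, hmin⟩ :=
    IsArtinian.set_has_minimal ((torsionSubmodule · M) '' s) (hs.image _)
  have hmem : of A (torsionSubmodule T M) ∈ (sInf s).carrier := fun U hU => by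
    obtain ⟨V, hV, hVT : V ≤ T, hVU : V ≤ U⟩ := hdir T hT U hU
    have heq : torsionSubmodule V M = torsionSubmodule T M :=
      (torsionSubmodule_mono M hVT).eq_of_not_lt (hmin _ ⟨V, hV, rfl⟩)
    exact hVU (heq ▸ torsionSubmodule_mem V M)
  exact ⟨T, hT, le_leftPerp_of_torsionSubmodule_eq_bot (eq_bot_of_le_leftPerp h hmem)⟩

variable (M) in
theorem isCompactElement_toDual_leftPerp [IsArtinian A M] :
    IsCompactElement (OrderDual.toDual (leftPerp M)) := by
  rw [CompleteLattice.isCompactElement_iff_le_of_directed_sSup_le]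
  exact fun _ hs hdir h => exists_le_leftPerp_of_sInf_le hs hdir h

end Noetherian

end TorsionClass

/-! ### Bricks -/

namespace IsBrick

open TorsionClass

variable {A : Type u} [Ring A] {S S' : FGModuleCat.{u} A}

theorem bijective (hS : IsBrick S) {f : Module.End A S} (hf : f ≠ 0) : Function.Bijective f :=
  (Module.End.isUnit_iff f).1 (hS.2 f hf)

theorem surjective_of_mem_gen (hS : IsBrick S) {X : FGModuleCat.{u} A} (hX : X ∈ (gen S).carrier)
    {f : X →ₗ[A] S} (hf : f ≠ 0) : Function.Surjective f := by
  have : Nontrivial (of A (LinearMap.range f)) :=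
    Submodule.nontrivial_iff_ne_bot.2 (mt LinearMap.range_eq_bot.1 hf)
  obtain ⟨g, hg⟩ := exists_ne_zero_of_mem_gen ((gen S).range_mem f hX)
  have hne : (LinearMap.range f).subtype ∘ₗ g ≠ 0 := fun h =>
    hg ((LinearMap.cancel_left (Submodule.injective_subtype _)).1
      (h.trans (LinearMap.comp_zero _).symm))
  have hsurj : Function.Surjective (LinearMap.range f).subtype :=
    .of_comp (g := g) (hS.bijective hne).surjective
  rw [← LinearMap.range_eq_top, Submodule.range_subtype] at hsurj
  exact LinearMap.range_eq_top.1 hsurj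

theorem quotient_mem_leftPerp (hS : IsBrick S) {K : Submodule A S} (hK : K ≠ ⊥) :
    of A (S ⧸ K) ∈ (leftPerp S).carrier := fun f => by
  by_contra hf
  have hne : f ∘ₗ K.mkQ ≠ 0 := fun h =>
    hf ((LinearMap.cancel_right K.mkQ_surjective).1 (h.trans (LinearMap.zero_comp _).symm))
  have hker : LinearMap.ker (f ∘ₗ K.mkQ) = ⊥ := LinearMap.ker_eq_bot.2 (hS.bijective hne).injective
  exact hK (le_bot_iff.1 (hker ▸ K.ker_mkQ.symm.le.trans (LinearMap.ker_le_ker_comp _ _)))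

theorem doubleArrow (hS : IsBrick S) : DoubleArrow (gen S) (leftPerp S) where
  not_le :=
    haveI := hS.1
    not_le_leftPerp_of_mem (mem_gen S)
  le_of_lt T hT := by
    by_contra hle
    obtain ⟨X, hX, f, hf⟩ := not_le_leftPerp_iff.1 hle
    have hsurj := hS.surjective_of_mem_gen (hT.le hX) hf
    exact hT.not_ge (gen_le_iff.2 (T.quotient_mem X S f hsurj hX))
  le_of_gt _ hT :=
    gen_le_iff.2 (mem_of_not_le_leftPerp (fun _ => hS.quotient_mem_leftPerp) hT.le hT.not_ge)

theorem nonempty_equiv_of_gen_eq (hS : IsBrick S) (hS' : IsBrick S') (h : gen S = gen S') :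
    Nonempty (S ≃ₗ[A] S') := by
  have := hS.1
  have := hS'.1
  obtain ⟨f, hf⟩ := exists_ne_zero_of_mem_gen (h ▸ mem_gen S' : S' ∈ (gen S).carrier)
  obtain ⟨g, hg⟩ := exists_ne_zero_of_mem_gen (h ▸ mem_gen S : S ∈ (gen S').carrier)
  have hgsurj : Function.Surjective g :=
    hS.surjective_of_mem_gen (h ▸ mem_gen S' : S' ∈ (gen S).carrier) hg
  have hne : f ∘ₗ g ≠ 0 := fun h0 =>
    hf ((LinearMap.cancel_right hgsurj).1 (h0.trans (LinearMap.zero_comp _).symm))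
  have hginj : Function.Injective g := .of_comp (f := f) (hS'.bijective hne).injective
  exact ⟨(LinearEquiv.ofBijective g ⟨hginj, hgsurj⟩).symm⟩

theorem hasLabel_iff (hS : IsBrick S) {q : HasseArrow (TorsionClass A)} :
    q.HasLabel (gen S) (leftPerp S) ↔ S ∈ q.src.carrier ∧ S ∈ q.tgt.perp :=
  ⟨fun h => ⟨gen_le_iff.1 h.le_src, h.tgt_le⟩, fun h => ⟨hS.doubleArrow, gen_le_iff.2 h.1, h.2⟩⟩

end IsBrick

namespace TorsionClass

variable {A : Type u} [Ring A] {T U : TorsionClass A}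

/-- The brick is a minimal nonzero submodule in `T` of a minimal quotient of `M` not in `U`. -/
theorem exists_isBrick {M : FGModuleCat.{u} A} [IsNoetherian A M] [IsArtinian A M]
    (hT : M ∈ T.carrier) (hU : M ∉ U.carrier) :
    ∃ S : FGModuleCat.{u} A, IsBrick S ∧ S ∈ T.carrier ∧ U ≤ leftPerp S ∧ IsSubquotient A S M ∧
      ∀ X ∈ T.carrier, ∀ f : X →ₗ[A] S, f ≠ 0 → Function.Surjective f := by
  obtain ⟨Q, p, hp, hQU, hquot⟩ := exists_minimal_quotient_notMem hU
  have := isNoetherian_of_surjective p (LinearMap.range_eq_top.2 hp)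
  have := isArtinian_of_surjective M p hp
  have hQT : Q ∈ T.carrier := T.quotient_mem M Q p hp hT
  have hUQ : U ≤ leftPerp Q := by_contra fun h => hQU (mem_of_not_le_leftPerp hquot le_rfl h)
  have := nontrivial_of_notMem hQU
  obtain ⟨N, ⟨hN0, hNT⟩, hmin⟩ := IsArtinian.set_has_minimal
    {N : Submodule A Q | N ≠ ⊥ ∧ of A N ∈ T.carrier}
    ⟨⊤, top_ne_bot, T.mem_of_equiv (N := of A (⊤ : Submodule A Q)) Submodule.topEquiv.symm hQT⟩
  have hsurj : ∀ X ∈ T.carrier, ∀ f : X →ₗ[A] of A N, f ≠ 0 → Function.Surjective f := by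
    intro X hX f hf
    let g : X →ₗ[A] Q := N.subtype ∘ₗ f
    have hg : g ≠ 0 := fun h =>
      hf ((LinearMap.cancel_left N.injective_subtype).1 (h.trans N.subtype.comp_zero.symm))
    have hgN : LinearMap.range g ≤ N := by
      simpa only [N.range_subtype] using LinearMap.range_comp_le_range f N.subtype
    have hgeq : LinearMap.range g = N := hgN.eq_of_not_lt
      (hmin _ ⟨mt LinearMap.range_eq_bot.1 hg, T.range_mem g hX⟩)
    intro y
    obtain ⟨x, hx⟩ := hgeq.ge y.2
    exact ⟨x, N.injective_subtype hx⟩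
  refine ⟨of A N, ⟨Submodule.nontrivial_iff_ne_bot.2 hN0, fun f hf => ?_⟩, hNT,
    hUQ.trans (leftPerp_le_of_injective (M := of A N) N.subtype N.injective_subtype),
    (((IsSubquotient.refl A M).of_surjective p hp).of_injective N.subtype N.injective_subtype),
    hsurj⟩
  have hfsurj := hsurj _ hNT f hf
  have hfinj := IsNoetherian.injective_of_surjective_endomorphism (M := N) f hfsurj
  exact (Module.End.isUnit_iff f).2 ⟨hfinj, hfsurj⟩

variable (A) in
theorem isSemidistributive [IsArtinianRing A] : IsSemidistributive (TorsionClass A) where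
  sup_inf_eq T V W h := by
    refine (sup_le_sup_left inf_le_left T).antisymm fun M hM => by_contra fun hM' => ?_
    obtain ⟨S, hS, hST, hle, -, hsurj⟩ := exists_isBrick hM hM'
    have hTS : T ≤ leftPerp S := le_sup_left.trans hle
    have mem_of_sup_eq : ∀ V', T ⊔ V' = T ⊔ V → S ∈ V'.carrier := fun V' hV' => by
      have hnot : ¬ V' ≤ leftPerp S := fun hV =>
        hS.doubleArrow.not_le ((gen_le_iff.2 (hV' ▸ hST)).trans (sup_le hTS hV))
      obtain ⟨X, hX, f, hf⟩ := not_le_leftPerp_iff.1 hnot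
      exact V'.quotient_mem X S f (hsurj X ((le_sup_right.trans hV'.le) hX) f hf) hX
    have hVW : S ∈ (V ⊓ W).carrier := mem_inf.2 ⟨mem_of_sup_eq V rfl, mem_of_sup_eq W h.symm⟩
    exact hS.doubleArrow.not_le ((gen_le_iff.2 hVW).trans (le_sup_right.trans hle))
  inf_sup_eq T V W h := by
    refine Eq.symm <| (inf_le_inf_left T le_sup_left).antisymm fun M hM => by_contra fun hM' => ?_
    obtain ⟨hMT, hMVW⟩ := mem_inf.1 hM
    obtain ⟨Q, p, hp, hQ, hquot⟩ := exists_minimal_quotient_notMem hM'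
    have hQT : Q ∈ T.carrier := T.quotient_mem M Q p hp hMT
    have le_leftPerp_of_inf_eq : ∀ V', T ⊓ V' = T ⊓ V → V' ≤ leftPerp Q := fun V' hV' =>
      by_contra fun hnot => hQ <| hV' ▸ mem_inf.2
        ⟨hQT, mem_of_not_le_leftPerp hquot (hV' ▸ inf_le_right) hnot⟩
    have := nontrivial_of_notMem hQ
    exact not_le_leftPerp_of_mem ((V ⊔ W).quotient_mem M Q p hp hMVW)
      (sup_le (le_leftPerp_of_inf_eq V rfl) (le_leftPerp_of_inf_eq W h.symm))

end TorsionClass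

/-! ### Forcing and subquotients -/

namespace TorsionClass

variable {A : Type u} [Ring A] {S S' : FGModuleCat.{u} A} {q q' : HasseArrow (TorsionClass A)}

theorem forall_gen_le_iff_forall_le_leftPerp_iff [IsNoetherianRing A] {X : Set (FGModuleCat.{u} A)}
    (hsub : ∀ M ∈ X, ∀ N : Submodule A M, of A N ∈ X)
    (hquot : ∀ M ∈ X, ∀ (Q : FGModuleCat.{u} A) (p : M →ₗ[A] Q), Function.Surjective p → Q ∈ X)
    (T U : TorsionClass A) :
    (∀ M : X, gen M.1 ≤ T ↔ gen M.1 ≤ U) ↔ ∀ M : X, T ≤ leftPerp M.1 ↔ U ≤ leftPerp M.1 := by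
  constructor
  · suffices key : ∀ T U : TorsionClass A, (∀ M : X, gen M.1 ≤ T ↔ gen M.1 ≤ U) →
        ∀ M : X, T ≤ leftPerp M.1 → U ≤ leftPerp M.1 from
      fun h M => ⟨key T U h M, key U T (fun N => (h N).symm) M⟩
    rintro T U h ⟨M, hM⟩ hT Y hY f
    have hrange : of A (LinearMap.range f) ∈ T.carrier :=
      gen_le_iff.1 ((h ⟨_, hsub M hM _⟩).2 (gen_le_iff.2 (U.range_mem f hY)))
    exact LinearMap.range_eq_bot.1 (eq_bot_of_le_leftPerp hT hrange)
  · suffices key : ∀ T U : TorsionClass A, (∀ M : X, T ≤ leftPerp M.1 ↔ U ≤ leftPerp M.1) →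
        ∀ M : X, gen M.1 ≤ T → gen M.1 ≤ U from
      fun h M => ⟨key T U h M, key U T (fun N => (h N).symm) M⟩
    rintro T U h ⟨M, hM⟩ hT
    refine gen_le_iff.2 (by_contra fun hMU => ?_)
    obtain ⟨Q, p, hp, hQU, hminimal⟩ := exists_minimal_quotient_notMem hMU
    have hUQ : U ≤ leftPerp Q :=
      by_contra fun hle => hQU (mem_of_not_le_leftPerp hminimal le_rfl hle)
    have := nontrivial_of_notMem hQU
    exact not_le_leftPerp_of_mem (T.quotient_mem M Q p hp (gen_le_iff.1 hT))
      ((h ⟨Q, hquot M hM Q p hp⟩).2 hUQ)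

/-- The congruence identifying two torsion classes that contain the same subquotients of `N`. -/
def subquotientCon [IsNoetherianRing A] (N : FGModuleCat.{u} A) : LatticeCon (TorsionClass A) :=
  polarCon (fun M : {M : FGModuleCat.{u} A | IsSubquotient A M N} => gen M.1)
    (fun M => leftPerp M.1) (forall_gen_le_iff_forall_le_leftPerp_iff
      (fun _ hM K => hM.of_injective K.subtype K.injective_subtype)
      fun _ hM _ p hp => hM.of_surjective p hp)

section Artinian

variable [IsArtinianRing A]

theorem nonempty_equiv_of_hasLabel (hS : IsBrick S) (hS' : IsBrick S')
    (h : q.HasLabel (gen S) (leftPerp S)) (h' : q.HasLabel (gen S') (leftPerp S')) :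
    Nonempty (S ≃ₗ[A] S') :=
  hS.nonempty_equiv_of_gen_eq hS' <|
    ((isSemidistributive A).isLeast_of_hasLabel h).unique
      ((isSemidistributive A).isLeast_of_hasLabel h')

theorem isSubquotient_of_forces (hS : IsBrick S) (h : q.HasLabel (gen S) (leftPerp S))
    (h' : q'.HasLabel (gen S') (leftPerp S')) (hforces : Forces q q') : IsSubquotient A S S' := by
  have hq' : ¬ (subquotientCon S').Contracts q' := fun hr =>
    h'.not_le (((hr ⟨S', .refl A S'⟩).1 h'.le_src).trans h'.tgt_le)
  have hq : ¬ ∀ M : {M : FGModuleCat.{u} A | IsSubquotient A M S'},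
      gen M.1 ≤ q.src ↔ gen M.1 ≤ q.tgt := fun hr => hq' (hforces (subquotientCon S') hr)
  obtain ⟨⟨M, hM⟩, hiff⟩ := not_forall.1 hq
  have hsrc : gen M ≤ q.src := by_contra fun hsrc =>
    hiff ⟨fun hle => absurd hle hsrc, fun hle => hle.trans q.covBy.le⟩
  have htgt : ¬ gen M ≤ q.tgt := fun htgt => hiff ⟨fun _ => htgt, fun _ => hsrc⟩
  obtain ⟨B, hB, hBsrc, hBtgt, hBM, -⟩ :=
    exists_isBrick (gen_le_iff.1 hsrc) (mt gen_le_iff.2 htgt)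
  obtain ⟨e⟩ := nonempty_equiv_of_hasLabel hB hS (hB.hasLabel_iff.2 ⟨hBsrc, hBtgt⟩) h
  exact (IsSubquotient.trans hBM hM).of_surjective e.toLinearMap e.surjective

theorem forcingEquiv_iff_nonempty_equiv (hS : IsBrick S) (hS' : IsBrick S')
    (h : q.HasLabel (gen S) (leftPerp S)) (h' : q'.HasLabel (gen S') (leftPerp S')) :
    ForcingEquiv q q' ↔ Nonempty (S ≃ₗ[A] S') := by
  constructor
  · rintro ⟨hforces, hforces'⟩
    exact (isSubquotient_of_forces hS h h' hforces).nonempty_equiv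
      (isSubquotient_of_forces hS' h' h hforces').length_le
  · rintro ⟨e⟩
    rw [← gen_eq_of_equiv e, ← leftPerp_eq_of_equiv e] at h'
    exact h.forcingEquiv h'

/-! ### The brick labelling -/

theorem exists_brick_hasLabel (q : HasseArrow (TorsionClass A)) :
    ∃ S : Brick A, q.HasLabel (gen S.1) (leftPerp S.1) := by
  obtain ⟨M, hsrc, htgt⟩ := Set.not_subset.1 q.covBy.lt.not_ge
  obtain ⟨S, hS, hST, hUS, -⟩ := exists_isBrick hsrc htgt
  exact ⟨⟨S, hS⟩, hS.hasLabel_iff.2 ⟨hST, hUS⟩⟩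

/-- A brick labelling the arrow `q`. It is unique only up to isomorphism, and a representative is
chosen. -/
noncomputable def brickLabel (q : HasseArrow (TorsionClass A)) : Brick A :=
  (exists_brick_hasLabel q).choose

theorem hasLabel_brickLabel (q : HasseArrow (TorsionClass A)) :
    q.HasLabel (gen (brickLabel q).1) (leftPerp (brickLabel q).1) :=
  (exists_brick_hasLabel q).choose_spec

variable (A) in
theorem isCompactLabelling_brickLabel :
    IsCompactLabelling (L := TorsionClass A) (fun q => gen (brickLabel q).1)
      fun q => leftPerp (brickLabel q).1 :=
  ⟨hasLabel_brickLabel, fun _ => isCompactElement_gen _,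
    fun _ => isCompactElement_toDual_leftPerp _⟩

variable (A) in
theorem isBrickLabelling_brickLabel :
    IsBrickLabelling fun q : HasseArrow (TorsionClass A) => (⟦brickLabel q⟧ : BrickClass A) := by
  refine fun q => Set.eq_singleton_iff_unique_mem.2 ⟨⟨brickLabel q, rfl, ?_⟩, ?_⟩
  · exact (brickLabel q).2.hasLabel_iff.1 (hasLabel_brickLabel q)
  · rintro _ ⟨S, rfl, hS⟩
    exact Quotient.sound <| nonempty_equiv_of_hasLabel S.2 (brickLabel q).2
      (S.2.hasLabel_iff.2 hS) (hasLabel_brickLabel q)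

theorem mk_brickLabel_eq_iff (q q' : HasseArrow (TorsionClass A)) :
    (⟦brickLabel q⟧ : BrickClass A) = ⟦brickLabel q'⟧ ↔ ForcingEquiv q q' :=
  Quotient.eq.trans (forcingEquiv_iff_nonempty_equiv (brickLabel q).2 (brickLabel q').2
    (hasLabel_brickLabel q) (hasLabel_brickLabel q')).symm

variable (A) in
theorem mk_brickLabel_surjective :
    Function.Surjective fun q : HasseArrow (TorsionClass A) => (⟦brickLabel q⟧ : BrickClass A) := by
  refine Quotient.ind fun S => ⟨S.2.doubleArrow.cjirr.arrow, Quotient.sound ?_⟩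
  exact nonempty_equiv_of_hasLabel (brickLabel _).2 S.2 (hasLabel_brickLabel _)
    S.2.doubleArrow.hasLabel_cjirr_arrow

theorem gen_eq_and_leftPerp_eq_of_forcingEquiv (h : ForcingEquiv q q') :
    gen (brickLabel q).1 = gen (brickLabel q').1 ∧
      leftPerp (brickLabel q).1 = leftPerp (brickLabel q').1 :=
  let ⟨e⟩ := Quotient.exact ((mk_brickLabel_eq_iff q q').2 h)
  ⟨gen_eq_of_equiv e, leftPerp_eq_of_equiv e⟩

end Artinian

end TorsionClass

open TorsionClass in
theorem mainTheorem4_general (A : Type u) [Ring A] [IsArtinianRing A] :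
    ∃ (lab : HasseArrow (TorsionClass A) → BrickClass A)
      (γ : HasseArrow (TorsionClass A) → CJIrr (TorsionClass A))
      (μ : HasseArrow (TorsionClass A) → CMIrr (TorsionClass A)),
      IsBrickLabelling lab ∧ IsJoinIrreducibleLabelling γ ∧ IsMeetIrreducibleLabelling μ ∧
      (∀ q q' : HasseArrow (TorsionClass A), lab q = lab q' ↔ ForcingEquiv q q') ∧
      Function.Surjective lab ∧
      IsCompletelyCongruenceUniform (TorsionClass A) ∧
      Function.Bijective (fun j : CJIrr (TorsionClass A) => lab j.arrow) ∧
      (∀ q : HasseArrow (TorsionClass A), lab (γ q).arrow = lab q ∧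
        IsLeast {T : TorsionClass A | q.tgt ⊔ T = q.src} (γ q).1) ∧
      Function.Bijective (fun m : CMIrr (TorsionClass A) => lab m.arrow) ∧
      (∀ q : HasseArrow (TorsionClass A), lab (μ q).arrow = lab q ∧
        IsGreatest {U : TorsionClass A | q.src ⊓ U = q.tgt} (μ q).1) := by
  have hlab := isCompactLabelling_brickLabel A
  have hsd := isSemidistributive A
  have hsurj := mk_brickLabel_surjective A
  have hγ := hlab.isJoinIrreducibleLabelling fun _ _ hq =>
    (gen_eq_and_leftPerp_eq_of_forcingEquiv hq).1
  have hμ := hlab.isMeetIrreducibleLabelling fun _ _ hq =>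
    (gen_eq_and_leftPerp_eq_of_forcingEquiv hq).2
  exact ⟨_, _, _, isBrickLabelling_brickLabel A, hγ, hμ, mk_brickLabel_eq_iff, hsurj,
    hlab.isCompletelyCongruenceUniform fun _ _ => gen_eq_and_leftPerp_eq_of_forcingEquiv,
    bijective_of_forcingEquiv_iff mk_brickLabel_eq_iff hγ hsurj,
    fun q => ⟨lab_eq_of_forcingEquiv_iff mk_brickLabel_eq_iff hγ q,
      hsd.isLeast_of_hasLabel (hlab.hasLabel q)⟩,
    bijective_of_forcingEquiv_iff mk_brickLabel_eq_iff hμ hsurj,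
    fun q => ⟨lab_eq_of_forcingEquiv_iff mk_brickLabel_eq_iff hμ q,
      hsd.isGreatest_of_hasLabel (hlab.hasLabel q)⟩⟩

theorem mainTheorem4 (k : Type*) (A : Type u) [Field k] [Ring A] [Algebra k A]
    [FiniteDimensional k A] :
    ∃ (lab : HasseArrow (TorsionClass A) → BrickClass A)
      (γ : HasseArrow (TorsionClass A) → CJIrr (TorsionClass A))
      (μ : HasseArrow (TorsionClass A) → CMIrr (TorsionClass A)),
      -- the brick labelling, the join-irreducible labelling and the meet-irreducible labelling
      -- exist (each of them is determined by its defining property)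
      IsBrickLabelling lab ∧ IsJoinIrreducibleLabelling γ ∧ IsMeetIrreducibleLabelling μ ∧
      -- (a)
      (∀ q q' : HasseArrow (TorsionClass A), lab q = lab q' ↔ ForcingEquiv q q') ∧
      Function.Surjective lab ∧
      -- (b)
      IsCompletelyCongruenceUniform (TorsionClass A) ∧
      -- (c)
      Function.Bijective (fun j : CJIrr (TorsionClass A) => lab j.arrow) ∧
      (∀ q : HasseArrow (TorsionClass A), lab (γ q).arrow = lab q ∧
        IsLeast {T : TorsionClass A | q.tgt ⊔ T = q.src} (γ q).1) ∧
      Function.Bijective (fun m : CMIrr (TorsionClass A) => lab m.arrow) ∧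
      (∀ q : HasseArrow (TorsionClass A), lab (μ q).arrow = lab q ∧
        IsGreatest {U : TorsionClass A | q.src ⊓ U = q.tgt} (μ q).1) := by
  have : IsArtinianRing A := IsArtinianRing.of_finite k A
  exact mainTheorem4_general A
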